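/- All Banach spaces are real. Let $X$ and $Y$ be Banach spaces, and let $X\widehat{\otimes}_\pi Y$ be their projective tensor product, that is, the completion of the algebraic tensor product $X\otimes Y$ under the norm $$\|z\|_\pi=\inf\Big\{\sum_{i=1}^n\|x_i\|\,\|y_i\| : z=\sum_{i=1}^n x_i\otimes y_i\Big\}.$$ A Banach space $E$ has the metric approximation property (MAP) if there is a net $(S_\alpha)$ of finite-rank bounded linear operators $S_\alpha:E\to E$ with $\|S_\alpha\|\le 1$ for every $\alpha$ and $S_\alpha(e)\to e$ for every $e\in E$. The norm of $E$ is strongly subdifferentiable (SSD) if, for every $e\in E$ with $\|e\|=1$, the one-sided limit $$\lim_{t\to 0^+}\frac{\|e+th\|-\|e\|}{t}$$ exists uniformly for $h$ in the unit sphere of $E$. Theorem 2.1. Assume that $X$ or $Y$ has the MAP and that the norm of $X\widehat{\otimes}_\pi Y$ is SSD. Then every bounded linear operator $T:X\to Y^*$ is compact. In particular, if in addition $X$ and $Y$ are reflexive, then $X\widehat{\otimes}_\pi Y$ is reflexive. -/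

import Mathlib

open scoped TensorProduct Topology

noncomputable section

namespace BanachTensor

/-- The set of all numbers `∑ i, ‖x i‖ * ‖y i‖`, over all finite representations
`z = ∑ i, x i ⊗ y i` of the tensor `z`. -/
def reprCosts {X Y : Type*} [NormedAddCommGroup X] [NormedSpace ℝ X]
    [NormedAddCommGroup Y] [NormedSpace ℝ Y] (z : X ⊗[ℝ] Y) : Set ℝ :=
  {r | ∃ (n : ℕ) (x : Fin n → X) (y : Fin n → Y),
    z = ∑ i, x i ⊗ₜ[ℝ] y i ∧ r = ∑ i, ‖x i‖ * ‖y i‖}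

/-- The projective norm `‖z‖_π`, the infimum of `∑ i, ‖x i‖ * ‖y i‖` over all representations
`z = ∑ i, x i ⊗ y i`. -/
def projNorm {X Y : Type*} [NormedAddCommGroup X] [NormedSpace ℝ X]
    [NormedAddCommGroup Y] [NormedSpace ℝ Y] (z : X ⊗[ℝ] Y) : ℝ :=
  sInf (reprCosts z)

section
variable {X Y : Type*} [NormedAddCommGroup X] [NormedSpace ℝ X]
    [NormedAddCommGroup Y] [NormedSpace ℝ Y]

theorem reprCosts_nonneg {z : X ⊗[ℝ] Y} {r : ℝ} (hr : r ∈ reprCosts z) : 0 ≤ r := by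
  obtain ⟨n, x, y, -, rfl⟩ := hr
  exact Finset.sum_nonneg fun i _ => by positivity

theorem reprCosts_bddBelow (z : X ⊗[ℝ] Y) : BddBelow (reprCosts z) :=
  ⟨0, fun _ hr => reprCosts_nonneg hr⟩

theorem reprCosts_zero : (0 : ℝ) ∈ reprCosts (0 : X ⊗[ℝ] Y) :=
  ⟨0, Fin.elim0, Fin.elim0, by simp, by simp⟩

theorem reprCosts_add {z w : X ⊗[ℝ] Y} {r s : ℝ} (hr : r ∈ reprCosts z)
    (hs : s ∈ reprCosts w) : r + s ∈ reprCosts (z + w) := by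
  obtain ⟨n, x, y, rfl, rfl⟩ := hr
  obtain ⟨m, x', y', rfl, rfl⟩ := hs
  exact ⟨n + m, Fin.append x x', Fin.append y y', by simp [Fin.sum_univ_add],
    by simp [Fin.sum_univ_add]⟩

theorem reprCosts_smul (c : ℝ) {z : X ⊗[ℝ] Y} {r : ℝ} (hr : r ∈ reprCosts z) :
    ‖c‖ * r ∈ reprCosts (c • z) := by
  obtain ⟨n, x, y, rfl, rfl⟩ := hr
  exact ⟨n, fun i => c • x i, y, by simp [Finset.smul_sum, TensorProduct.smul_tmul'],
    by simp [Finset.mul_sum, norm_smul, mul_assoc]⟩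

theorem reprCosts_nonempty (z : X ⊗[ℝ] Y) : (reprCosts z).Nonempty := by
  induction z with
  | zero => exact ⟨0, reprCosts_zero⟩
  | tmul x y => exact ⟨‖x‖ * ‖y‖, 1, fun _ => x, fun _ => y, by simp, by simp⟩
  | add z w hz hw =>
    obtain ⟨r, hr⟩ := hz
    obtain ⟨s, hs⟩ := hw
    exact ⟨r + s, reprCosts_add hr hs⟩

theorem projNorm_zero : projNorm (0 : X ⊗[ℝ] Y) = 0 :=
  le_antisymm (csInf_le (reprCosts_bddBelow _) reprCosts_zero)
    (le_csInf (reprCosts_nonempty _) fun _ hr => reprCosts_nonneg hr)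

theorem projNorm_add_le (z w : X ⊗[ℝ] Y) : projNorm (z + w) ≤ projNorm z + projNorm w := by
  refine le_of_forall_pos_le_add fun ε hε => ?_
  obtain ⟨r, hr, hr'⟩ := Real.lt_sInf_add_pos (reprCosts_nonempty z) (half_pos hε)
  obtain ⟨s, hs, hs'⟩ := Real.lt_sInf_add_pos (reprCosts_nonempty w) (half_pos hε)
  have h : projNorm (z + w) ≤ r + s := csInf_le (reprCosts_bddBelow _) (reprCosts_add hr hs)
  unfold projNorm at h ⊢
  linarith

theorem projNorm_smul_le (c : ℝ) (z : X ⊗[ℝ] Y) :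
    projNorm (c • z) ≤ ‖c‖ * projNorm z := by
  refine le_of_forall_pos_le_add fun ε hε => ?_
  have hd : 0 < ε / (‖c‖ + 1) := by positivity
  obtain ⟨r, hr, hr'⟩ := Real.lt_sInf_add_pos (reprCosts_nonempty z) hd
  have h : projNorm (c • z) ≤ ‖c‖ * r := csInf_le (reprCosts_bddBelow _) (reprCosts_smul c hr)
  have h1 : ‖c‖ * r ≤ ‖c‖ * (projNorm z + ε / (‖c‖ + 1)) :=
    mul_le_mul_of_nonneg_left hr'.le (norm_nonneg c)
  have h2 : ‖c‖ * (ε / (‖c‖ + 1)) ≤ ε := by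
    rw [← mul_div_assoc, div_le_iff₀ (by positivity)]
    nlinarith [norm_nonneg c]
  linarith [mul_add ‖c‖ (projNorm z) (ε / (‖c‖ + 1))]

end

/-- The projective norm as a seminorm on the algebraic tensor product. -/
def projSeminorm (X Y : Type*) [NormedAddCommGroup X] [NormedSpace ℝ X]
    [NormedAddCommGroup Y] [NormedSpace ℝ Y] : Seminorm ℝ (X ⊗[ℝ] Y) :=
  Seminorm.ofSMulLE projNorm projNorm_zero projNorm_add_le projNorm_smul_le

/-- The algebraic tensor product `X ⊗ Y`, as a type of its own that carries the projective
norm. -/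
def AlgTensor (X Y : Type*) [NormedAddCommGroup X] [NormedSpace ℝ X]
    [NormedAddCommGroup Y] [NormedSpace ℝ Y] : Type _ :=
  X ⊗[ℝ] Y

section
variable (X Y : Type*) [NormedAddCommGroup X] [NormedSpace ℝ X]
    [NormedAddCommGroup Y] [NormedSpace ℝ Y]

instance : AddCommGroup (AlgTensor X Y) := inferInstanceAs (AddCommGroup (X ⊗[ℝ] Y))

instance : Module ℝ (AlgTensor X Y) := inferInstanceAs (Module ℝ (X ⊗[ℝ] Y))

instance : SeminormedAddCommGroup (AlgTensor X Y) :=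
  AddGroupSeminorm.toSeminormedAddCommGroup (E := AlgTensor X Y)
    (projSeminorm X Y).toAddGroupSeminorm

instance : NormedSpace ℝ (AlgTensor X Y) where
  norm_smul_le c z := projNorm_smul_le (X := X) (Y := Y) c z

end

/-- The projective tensor product of `X` and `Y`: the completion of the algebraic tensor product
under the projective norm. -/
abbrev ProjTensor (X Y : Type*) [NormedAddCommGroup X] [NormedSpace ℝ X]
    [NormedAddCommGroup Y] [NormedSpace ℝ Y] : Type _ :=
  UniformSpace.Completion (AlgTensor X Y)

/-- The norm of `E` is strongly subdifferentiable: for every `x` in the unit sphere the one-sided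
limit of `(‖x + t h‖ - ‖x‖) / t` as `t → 0⁺` exists uniformly for `h` in the unit sphere. -/
def IsSSD (E : Type*) [NormedAddCommGroup E] [NormedSpace ℝ E] : Prop :=
  ∀ x : E, ‖x‖ = 1 → ∃ L : E → ℝ,
    TendstoUniformlyOn (fun (t : ℝ) (h : E) => (‖x + t • h‖ - ‖x‖) / t) L (𝓝[>] 0)
      (Metric.sphere (0 : E) 1)

universe u in
/-- The metric approximation property: there is a net of finite-rank operators of norm at most
one on `E` that converges pointwise to the identity. Nets indexed in the universe of `E` suffice,
as one can index by the finite subsets of `E`, together with a tolerance `1 / (n + 1)`. -/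
def HasMAP (E : Type u) [NormedAddCommGroup E] [NormedSpace ℝ E] : Prop :=
  ∃ (ι : Type u) (_ : Preorder ι) (_ : IsDirectedOrder ι) (_ : Nonempty ι) (S : ι → E →L[ℝ] E),
    (∀ a, FiniteDimensional ℝ (LinearMap.range (S a).toLinearMap)) ∧
    (∀ a, ‖S a‖ ≤ 1) ∧
    ∀ x : E, Filter.Tendsto (fun a => S a x) Filter.atTop (𝓝 x)

/-- Reflexivity: the canonical embedding of `E` into its bidual is onto. -/
def IsReflexiveSpace (E : Type*) [NormedAddCommGroup E] [NormedSpace ℝ E] : Prop :=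
  Function.Surjective (NormedSpace.inclusionInDoubleDual ℝ E)

end BanachTensor

end

/-! The dual of the projective tensor product Z is isometric to the space of operators X → Y*, and
the compact operators form a closed subspace of it. The MAP makes that subspace norming: composing T
with the finite-rank S_a on the X side, or with their adjoints on the Y* side, approximates T
pointwise without increasing its norm. It remains to see that under SSD the dual has no proper
closed norming subspace (`IsSSD.eq_top_of_isNorming`).

The engine is `IsNorming.dense_span`. If φ is at positive distance from the span of a norming set A,
Helly's theorem yields a bounded sequence x with φ(x n) ≥ c > 0 such that each u in the closed
convex hull of x is almost normed by elements of A vanishing on a tail of x. Simons' inequality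
produces such a u for which every functional attaining its norm at u is nearly ‖u‖ somewhere in the
closed convex hull of each tail. A norming functional that is small on a tail then forces ‖u‖, hence
c, to be too small. SSD supplies it, since almost norming functionals are close to norming ones
(`IsSSD.exists_norming_near`).

Reflexivity reuses the engine one dual higher, with A the elementary tensors of the unit balls
inside Z**. Here compactness replaces SSD: bounded elementary tensors have weak limits that are
again elementary tensors. So Z is dense in Z**, and being complete it is all of Z**. -/

namespace BanachTensor

open Filter Set

/-! ### Simons' inequality and norming sets -/

section Simons

variable {E : Type*} [NormedAddCommGroup E] [NormedSpace ℝ E]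

/-- A form of Simons' inequality for a decreasing sequence of closed convex sets. -/
theorem exists_forall_attaining_of_antitone [CompleteSpace E] {C : ℕ → Set E}
    (hconv : ∀ n, Convex ℝ (C n)) (hclosed : ∀ n, IsClosed (C n))
    (hne : ∀ n, (C n).Nonempty) (hanti : Antitone C) (hbdd : ∀ x ∈ C 0, ‖x‖ ≤ 1)
    {δ : ℝ} (hδ : 0 < δ) :
    ∃ u ∈ C 0, ∀ f : StrongDual ℝ E, ‖f‖ ≤ 1 → f u = ‖u‖ → ∀ n, ∃ w ∈ C n, ‖u‖ - δ ≤ f w := by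
  set q : ℝ := 1 / 2 with hq
  have hq0 : ∀ n : ℕ, 0 < q ^ n := fun n => by positivity
  -- The minimum need not be attained. The error is quadratic in q ^ n so that the accumulated
  -- errors remain at most δ after division by q ^ n.
  have hmin : ∀ (n : ℕ) (s : E), ∃ y ∈ C n, ∀ z ∈ C n,
      ‖s + q ^ n • y‖ ≤ ‖s + q ^ n • z‖ + δ / 2 * (q ^ n) ^ 2 := by
    intro n s
    have hne' : ((fun z => ‖s + q ^ n • z‖) '' C n).Nonempty := (hne n).image _
    have hb : BddBelow ((fun z => ‖s + q ^ n • z‖) '' C n) :=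
      ⟨0, by rintro _ ⟨z, -, rfl⟩; positivity⟩
    obtain ⟨_, ⟨y, hy, rfl⟩, hlt⟩ := Real.lt_sInf_add_pos hne'
      (show 0 < δ / 2 * (q ^ n) ^ 2 by have := hq0 n; positivity)
    refine ⟨y, hy, fun z hz => ?_⟩
    have := csInf_le hb ⟨z, hz, rfl⟩
    simp only at this hlt
    linarith
  choose Y hYC hYmin using hmin
  -- Partial sums of a series with weights 1/2, 1/4, ... of total 1; its sum u is an infinite convex
  -- combination of the chosen points.
  let s : ℕ → E := fun n => Nat.rec 0 (fun n s => s + q ^ (n + 1) • Y n s) n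
  have hs0 : s 0 = 0 := rfl
  have hs : ∀ n, s (n + 1) = s n + q ^ (n + 1) • Y n (s n) := fun n => rfl
  have hnorm : ∀ n, ∀ z ∈ C n, ‖z‖ ≤ 1 := fun n z hz => hbdd z (hanti (Nat.zero_le n) hz)
  have hcauchy : CauchySeq s := by
    refine cauchySeq_of_le_geometric q 1 (by norm_num [hq]) fun n => ?_
    rw [dist_eq_norm, hs, sub_add_cancel_left, norm_neg, norm_smul, pow_succ,
      Real.norm_of_nonneg (by positivity)]
    have := hnorm n _ (hYC n (s n))
    have := hq0 n
    rw [mul_assoc, one_mul]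
    refine mul_le_of_le_one_right this.le ?_
    rw [hq]
    linarith
  obtain ⟨u, hu⟩ := cauchySeq_tendsto_of_complete hcauchy
  -- The finite stretch from n to n + k, rescaled by 2 ^ n, has weight 1 - q ^ k; the point z
  -- supplies the missing q ^ k.
  have hpart : ∀ n k, ∀ z ∈ C (n + k),
      (2 : ℝ) ^ n • (s (n + k) - s n) + q ^ k • z ∈ C n := by
    intro n k
    induction k with
    | zero => intro z hz; simpa using hz
    | succ k ih =>
      intro z hz
      have hz' : z ∈ C (n + k) := hanti (by omega) hz
      have := ih _ ((hconv (n + k)) (hYC (n + k) (s (n + k))) hz'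
        (by norm_num : (0 : ℝ) ≤ 1 / 2) (by norm_num : (0 : ℝ) ≤ 1 / 2) (by norm_num))
      convert this using 1
      rw [← add_assoc n k 1, hs]
      have h2 : (2 : ℝ) ^ n * q ^ n = 1 := by rw [← mul_pow]; norm_num [hq]
      have e1 : (2 : ℝ) ^ n * q ^ (n + k + 1) = q ^ k * (1 / 2) := by
        rw [pow_succ, pow_add]; linear_combination q ^ k * q * h2
      have e2 : q ^ (k + 1) = q ^ k * (1 / 2) := by rw [pow_succ]
      rw [add_sub_right_comm, smul_add, smul_smul, e1, e2, smul_add, smul_smul, smul_smul,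
        add_assoc]
  have htail : ∀ n, (2 : ℝ) ^ n • (u - s n) ∈ C n := by
    intro n
    have hsk : Tendsto (fun k => s (n + k)) atTop (𝓝 u) := by
      simp only [add_comm n]
      exact hu.comp (tendsto_add_atTop_nat n)
    have hz : Tendsto (fun k => q ^ k • Y (n + k) (s (n + k))) atTop (𝓝 0) := by
      refine squeeze_zero_norm (a := fun k => q ^ k) (fun k => ?_)
        (tendsto_pow_atTop_nhds_zero_of_lt_one (by norm_num [hq]) (by norm_num [hq]))
      rw [norm_smul, Real.norm_of_nonneg (hq0 k).le]
      exact mul_le_of_le_one_right (hq0 k).le (hnorm _ _ (hYC _ _))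
    have hlim := ((hsk.sub_const (s n)).const_smul ((2 : ℝ) ^ n)).add hz
    rw [add_zero] at hlim
    exact (hclosed n).mem_of_tendsto hlim
      (Eventually.of_forall fun k => hpart n k _ (hYC _ _))
  refine ⟨u, by simpa [hs0] using htail 0, fun f hf hfu n => ⟨_, htail n, ?_⟩⟩
  have hqn : ∀ n, q ^ n * 2 ^ n = 1 := fun n => by rw [← mul_pow]; norm_num [hq]
  have hle : ∀ x, f x ≤ ‖x‖ := fun x =>
    (le_abs_self _).trans ((f.le_opNorm x).trans (mul_le_of_le_one_left (norm_nonneg x) hf))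
  -- Since s (n + 1) is the midpoint of s n and s n + q ^ n y, this solves the recursion given by
  -- near-minimality against the rescaled tail, for which s n + q ^ n z = u.
  have hfs : ∀ n, f (s n) ≤ (1 - q ^ n) * ‖u‖ + δ / 2 * (2 * q ^ n - 2 * (q ^ n) ^ 2) := by
    intro n
    induction n with
    | zero => simp [hs0]
    | succ n ih =>
      have h1 : ‖s n + q ^ n • Y n (s n)‖ ≤ ‖u‖ + δ / 2 * (q ^ n) ^ 2 := by
        have := hYmin n (s n) _ (htail n)
        rwa [smul_smul, hqn, one_smul, add_sub_cancel] at this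
      have h2 := (hle _).trans h1
      rw [hs]
      simp only [map_add, map_smul, smul_eq_mul] at h2 ⊢
      rw [pow_succ]
      have : q = 1 / 2 := hq
      rw [this] at *
      nlinarith
  have h3 := hfs n
  rw [map_smul, map_sub, hfu, smul_eq_mul]
  have h4 : q ^ n * (‖u‖ - δ) ≤ ‖u‖ - f (s n) := by nlinarith [hq0 n, sq_nonneg (q ^ n)]
  have h5 : (0 : ℝ) < 2 ^ n := by positivity
  calc ‖u‖ - δ = 2 ^ n * (q ^ n * (‖u‖ - δ)) := by rw [← mul_assoc, mul_comm (2 ^ n), hqn, one_mul]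
    _ ≤ _ := by gcongr

/-- Helly's theorem for finitely many annihilated functionals. -/
theorem exists_norm_le_one_lt_apply {S : Set (StrongDual ℝ E)} (hS : S.Finite)
    {f : StrongDual ℝ E} {c : ℝ} (hc : ∀ g ∈ Submodule.span ℝ S, c < ‖f - g‖) :
    ∃ x : E, ‖x‖ ≤ 1 ∧ c < f x ∧ ∀ g ∈ S, g x = 0 := by
  by_contra! hcon
  have : Finite S := hS
  let N : Submodule ℝ E := ⨅ g : S, LinearMap.ker (g : StrongDual ℝ E).toLinearMap
  have hN : ∀ x ∈ N, ∀ g ∈ S, g x = 0 := fun x hx g hg => by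
    simpa using (Submodule.mem_iInf _).1 hx ⟨g, hg⟩
  have hle : ∀ x ∈ N, ‖x‖ ≤ 1 → f x ≤ c := fun x hx hx1 => by
    by_contra! h
    obtain ⟨g, hg, hg0⟩ := hcon x hx1 h
    exact hg0 (hN x hx g hg)
  have hc0 : 0 ≤ c := by simpa using hle 0 N.zero_mem (by simp)
  have hres : ‖f.comp N.subtypeL‖ ≤ c := by
    refine ContinuousLinearMap.opNorm_le_of_unit_norm hc0 fun x hx => ?_
    rw [Real.norm_eq_abs, abs_le]
    have h1 := hle x x.2 (by simpa using hx.le)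
    have h2 := hle (-x) (N.neg_mem x.2) (by simpa using hx.le)
    rw [map_neg] at h2
    simp only [ContinuousLinearMap.comp_apply, Submodule.subtypeL_apply]
    constructor <;> linarith
  -- f - e vanishes on the common kernel N, so it lies in the span of S; yet its distance to f is
  -- ‖e‖ ≤ c.
  obtain ⟨e, he, hen⟩ := _root_.exists_extension_norm_eq N (f.comp N.subtypeL)
  have hmem : f - e ∈ Submodule.span ℝ S := by
    have h1 : (f - e).toLinearMap ∈
        Submodule.span ℝ (range fun g : S => (g : StrongDual ℝ E).toLinearMap) := by
      refine mem_span_of_iInf_ker_le_ker fun x hx => ?_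
      have := he ⟨x, hx⟩
      simp only [ContinuousLinearMap.comp_apply, Submodule.subtypeL_apply] at this
      simp [this]
    have h2 : (range fun g : S => (g : StrongDual ℝ E).toLinearMap) =
        ContinuousLinearMap.coeLM ℝ '' S := by
      ext g; simp
    rw [h2, Submodule.span_image] at h1
    obtain ⟨g, hg, hge⟩ := h1
    have : g = f - e := ContinuousLinearMap.coe_injective hge
    exact this ▸ hg
  have := hc _ hmem
  rw [sub_sub_cancel, hen] at this
  linarith

/-- `A` is a set of functionals in the unit ball that recovers the norm. -/
def IsNorming (A : Set (StrongDual ℝ E)) : Prop :=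
  (∀ g ∈ A, ‖g‖ ≤ 1) ∧ ∀ (x : E) (r : ℝ), r < ‖x‖ → ∃ g ∈ A, r < g x

/-- For each g, almost norming is an open condition on the point, so compactness leaves finitely
many g. -/
theorem IsNorming.exists_finite {A : Set (StrongDual ℝ E)} (hA : IsNorming A) {K : Set E}
    (hK : IsCompact K) {η : ℝ} (hη : 0 < η) :
    ∃ G ⊆ A, G.Finite ∧ ∀ y ∈ K, ∃ g ∈ G, ‖y‖ - η < g y := by
  have h := fun y : E => hA.2 y (‖y‖ - η) (by linarith)
  choose g hgA hg using h
  obtain ⟨t, -, ht⟩ := hK.elim_nhds_subcover (fun y => {z | ‖z‖ - η < g y z})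
    fun y _ => (isOpen_lt (by fun_prop) (by fun_prop)).mem_nhds (hg y)
  refine ⟨g '' t, by rintro _ ⟨y, -, rfl⟩; exact hgA y, t.finite_toSet.image g, fun y hy => ?_⟩
  obtain ⟨z, hz, hyz⟩ := mem_iUnion₂.1 (ht hy)
  exact ⟨g z, mem_image_of_mem g hz, hyz⟩

/-- Points and finite subsets of A are chosen alternately: the subset is enlarged until it almost
norms the compact convex hull of the points so far, and Helly's theorem gives the next point in its
annihilator. -/
theorem IsNorming.exists_seq {A : Set (StrongDual ℝ E)} (hA : IsNorming A)
    {f : StrongDual ℝ E} (hf : f ∉ closure (Submodule.span ℝ A : Set (StrongDual ℝ E))) :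
    ∃ c : ℝ, 0 < c ∧ ∃ x : ℕ → E, (∀ n, ‖x n‖ ≤ 1) ∧ (∀ n, c ≤ f (x n)) ∧
      ∀ u ∈ closure (convexHull ℝ (range x)), ∀ η > 0,
        ∃ g ∈ A, ‖u‖ - η < g u ∧ ∀ᶠ m in atTop, g (x m) = 0 := by
  obtain ⟨c, hc, hcf⟩ : ∃ c : ℝ, 0 < c ∧ ∀ g ∈ Submodule.span ℝ A, c < ‖f - g‖ := by
    rw [Metric.mem_closure_iff] at hf
    push Not at hf
    obtain ⟨c, hc, h⟩ := hf
    exact ⟨c / 2, by positivity, fun g hg => by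
      have := h g hg; rw [dist_eq_norm] at this; linarith⟩
  have hX : ∀ S : {S : Set (StrongDual ℝ E) // S.Finite ∧ S ⊆ A},
      ∃ x : E, ‖x‖ ≤ 1 ∧ c < f x ∧ ∀ g ∈ S.1, g x = 0 := fun S =>
    exists_norm_le_one_lt_apply S.2.1 fun g hg => hcf g (Submodule.span_mono S.2.2 hg)
  choose X hX1 hXf hX0 using hX
  have hG : ∀ (P : {P : Set E // P.Finite}) (n : ℕ), ∃ G : Set (StrongDual ℝ E), G ⊆ A ∧ G.Finite ∧
      ∀ y ∈ convexHull ℝ P.1, ∃ g ∈ G, ‖y‖ - 1 / ((n : ℝ) + 1) < g y := fun P n =>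
    hA.exists_finite (P.2.isCompact_convexHull ℝ) (by positivity)
  choose G hGA hGfin hG using hG
  -- The state is a pair (points chosen, functionals to annihilate).
  let enlarge : ℕ → {P : Set E // P.Finite} × {S : Set (StrongDual ℝ E) // S.Finite ∧ S ⊆ A} →
      {S : Set (StrongDual ℝ E) // S.Finite ∧ S ⊆ A} := fun n p =>
    ⟨p.2.1 ∪ G p.1 n, p.2.2.1.union (hGfin _ _), union_subset p.2.2.2 (hGA _ _)⟩
  let step : ℕ → {P : Set E // P.Finite} × {S : Set (StrongDual ℝ E) // S.Finite ∧ S ⊆ A} →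
      {P : Set E // P.Finite} × {S : Set (StrongDual ℝ E) // S.Finite ∧ S ⊆ A} := fun n p =>
    (⟨insert (X (enlarge n p)) p.1.1, p.1.2.insert _⟩, enlarge n p)
  let p : ℕ → {P : Set E // P.Finite} × {S : Set (StrongDual ℝ E) // S.Finite ∧ S ⊆ A} :=
    fun n => Nat.rec (⟨∅, finite_empty⟩, ⟨∅, finite_empty, empty_subset _⟩) step n
  have hp : ∀ n, p (n + 1) = step n (p n) := fun n => rfl
  -- The index n + 1 matters: the point x n must already annihilate the functionals added at step n.
  let x : ℕ → E := fun n => X (p (n + 1)).2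
  have hP : Monotone fun n => (p n).1.1 := monotone_nat_of_le_succ fun n => subset_insert _ _
  have hS : Monotone fun n => (p n).2.1 := monotone_nat_of_le_succ fun n => subset_union_left
  have hxP : ∀ n, x n ∈ (p (n + 1)).1.1 := fun n => mem_insert _ _
  have hGS : ∀ n, G (p n).1 n ⊆ (p (n + 1)).2.1 := fun n => subset_union_right
  refine ⟨c, hc, x, fun n => hX1 _, fun n => (hXf _).le, fun u hu η hη => ?_⟩
  obtain ⟨y, hy, huy⟩ := Metric.mem_closure_iff.1 hu (η / 3) (by positivity)
  have hunion : convexHull ℝ (range x) ⊆ ⋃ n, convexHull ℝ (p n).1.1 := by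
    refine convexHull_min ?_ (Directed.convex_iUnion ?_ fun n => convex_convexHull ℝ _)
    · rintro _ ⟨n, rfl⟩
      exact mem_iUnion.2 ⟨n + 1, subset_convexHull ℝ _ (hxP n)⟩
    · exact (show Monotone fun n => convexHull ℝ (p n).1.1 from
        fun m n h => convexHull_mono (hP h)).directed_le
  obtain ⟨n, hn⟩ := mem_iUnion.1 (hunion hy)
  obtain ⟨k, hk⟩ := exists_nat_one_div_lt (show 0 < η / 3 by positivity)
  set N := max n k
  obtain ⟨g, hg, hgy⟩ := hG (p N).1 N y (convexHull_mono (hP (le_max_left n k)) hn)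
  have hN : 1 / ((N : ℝ) + 1) < η / 3 :=
    (one_div_le_one_div_of_le (by positivity) (by simp [N])).trans_lt hk
  refine ⟨g, hGA _ _ hg, ?_, ?_⟩
  · have h1 : ‖g (y - u)‖ ≤ ‖y - u‖ :=
      (g.le_opNorm _).trans (mul_le_of_le_one_left (norm_nonneg _) (hA.1 g (hGA _ _ hg)))
    have h2 : ‖u‖ ≤ ‖y‖ + ‖y - u‖ := by
      have := norm_sub_le y (y - u); rwa [sub_sub_cancel] at this
    rw [dist_comm, dist_eq_norm] at huy
    rw [Real.norm_eq_abs, map_sub] at h1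
    linarith [le_abs_self (g y - g u)]
  · filter_upwards [eventually_ge_atTop N] with m hm
    exact hX0 _ g (hS (show N + 1 ≤ m + 1 by omega) (hGS N hg))

/-- A norming set spans a dense subspace of the dual as soon as almost norming elements of it
that annihilate the tail of a sequence can be replaced by norming functionals that are small on
the tail of this sequence. -/
theorem IsNorming.dense_span [CompleteSpace E] {A : Set (StrongDual ℝ E)} (hA : IsNorming A)
    (H : ∀ x : ℕ → E, (∀ n, ‖x n‖ ≤ 1) → ∀ u : E, u ≠ 0 →
      (∀ η > 0, ∃ g ∈ A, ‖u‖ - η < g u ∧ ∀ᶠ m in atTop, g (x m) = 0) →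
      ∀ ε > 0, ∃ f : StrongDual ℝ E, ‖f‖ ≤ 1 ∧ f u = ‖u‖ ∧ ∀ᶠ m in atTop, f (x m) ≤ ε) :
    closure (Submodule.span ℝ A : Set (StrongDual ℝ E)) = univ := by
  refine eq_univ_of_forall fun φ => ?_
  by_contra hφ
  obtain ⟨c, hc, x, hx1, hxc, hx⟩ := hA.exists_seq hφ
  let C : ℕ → Set E := fun n => closure (convexHull ℝ (x '' Ici n))
  have hsub : ∀ {n : ℕ} {D : Set E}, Convex ℝ D → IsClosed D → (∀ m ≥ n, x m ∈ D) → C n ⊆ D :=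
    fun hD hD' h => closure_minimal (convexHull_min (by rintro _ ⟨m, hm, rfl⟩; exact h m hm) hD) hD'
  -- The end of the argument gives ‖u‖ ≤ 2ε, whereas c ≤ ‖φ‖ ‖u‖; this ε makes the two incompatible.
  set ε : ℝ := c / (4 * (‖φ‖ + 1)) with hε
  have hε0 : 0 < ε := by positivity
  obtain ⟨u, hu, huf⟩ := exists_forall_attaining_of_antitone (C := C)
    (fun n => (convex_convexHull ℝ _).closure) (fun n => isClosed_closure)
    (fun n => ⟨x n, subset_closure (subset_convexHull ℝ _ ⟨n, self_mem_Ici, rfl⟩)⟩)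
    (fun m n h => closure_mono (convexHull_mono (image_mono (Ici_subset_Ici.2 h))))
    (fun y hy => by
      simpa using hsub (n := 0) (convex_closedBall (0 : E) 1) Metric.isClosed_closedBall
        (fun m _ => by simpa using hx1 m) hy) hε0
  have hcu : c ≤ φ u := hsub (n := 0) (D := {y | c ≤ φ y})
    (convex_halfSpace_ge φ.toLinearMap.isLinear c) (isClosed_le (by fun_prop) (by fun_prop))
    (fun m _ => hxc m) hu
  have hu0 : u ≠ 0 := by
    rintro rfl
    simp only [map_zero] at hcu
    linarith
  obtain ⟨f, hf1, hfu, hfx⟩ := H x hx1 u hu0 (fun η hη => hx u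
    (closure_mono (convexHull_mono (image_subset_range _ _)) hu) η hη) ε hε0
  obtain ⟨n, hn⟩ := eventually_atTop.1 hfx
  obtain ⟨w, hw, hfw⟩ := huf f hf1 hfu n
  have hwε : f w ≤ ε := hsub (D := {y | f y ≤ ε})
    (convex_halfSpace_le f.toLinearMap.isLinear ε) (isClosed_le (by fun_prop) (by fun_prop)) hn hw
  have h1 : c ≤ ‖φ‖ * ‖u‖ := hcu.trans ((le_abs_self _).trans (φ.le_opNorm u))
  have h2 : ε * (4 * (‖φ‖ + 1)) = c := by rw [hε]; field_simp
  nlinarith [norm_nonneg φ, norm_nonneg u]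

end Simons

/-! ### Strong subdifferentiability and norming functionals -/

section SSD

variable {E : Type*} [NormedAddCommGroup E] [NormedSpace ℝ E]

/-- A sandwich form of the Hahn-Banach theorem. -/
theorem exists_le_sublinear_of_le_add_norm {p : E → ℝ}
    (hhom : ∀ c : ℝ, 0 < c → ∀ x, p (c • x) = c * p x)
    (hadd : ∀ x y, p (x + y) ≤ p x + p y) (hp : ∀ x, p x ≤ ‖x‖) {ε : ℝ} (hε : 0 ≤ ε)
    {f : StrongDual ℝ E} (hf : ∀ h, f h ≤ p h + ε * ‖h‖) :
    ∃ g : StrongDual ℝ E, ‖g‖ ≤ 1 ∧ (∀ h, g h ≤ p h) ∧ ‖f - g‖ ≤ ε := by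
  have hp0 : p 0 = 0 := by
    have := hhom 2 (by norm_num) 0
    rw [smul_zero] at this
    linarith
  -- f is placed on the diagonal of E × E and extended below p(h) + ε‖k‖; restricting the extension
  -- to the two factors splits f into g and a remainder of norm at most ε.
  let D : E × E →ₗ.[ℝ] ℝ :=
    ⟨LinearMap.range (LinearMap.id.prod LinearMap.id : E →ₗ[ℝ] E × E),
      (f.toLinearMap ∘ₗ LinearMap.fst ℝ E E).domRestrict _⟩
  obtain ⟨Φ, hΦD, hΦ⟩ := exists_extension_of_le_sublinear D (fun z => p z.1 + ε * ‖z.2‖)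
    (fun c hc z => by
      simp only [Prod.smul_fst, Prod.smul_snd, hhom c hc, norm_smul, Real.norm_of_nonneg hc.le]
      ring)
    (fun z w => by
      have h1 := hadd z.1 w.1
      have h2 := mul_le_mul_of_nonneg_left (norm_add_le z.2 w.2) hε
      simp only [Prod.fst_add, Prod.snd_add]
      linarith)
    (by rintro ⟨_, ⟨h, rfl⟩⟩; exact hf h)
  have hsum : ∀ h, Φ (h, 0) + Φ (0, h) = f h := fun h => by
    rw [← map_add, Prod.mk_add_mk, add_zero, zero_add]
    exact hΦD ⟨(h, h), h, rfl⟩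
  have hg : ∀ h, Φ (h, 0) ≤ p h := fun h => by simpa using hΦ (h, 0)
  have he : ∀ h, Φ (0, h) ≤ ε * ‖h‖ := fun h => by simpa [hp0] using hΦ (0, h)
  have hneg1 : ∀ h, Φ (-h, 0) = -Φ (h, 0) := fun h => by rw [← map_neg]; simp
  have hneg2 : ∀ h, Φ (0, -h) = -Φ (0, h) := fun h => by rw [← map_neg]; simp
  let g : StrongDual ℝ E := (Φ ∘ₗ LinearMap.inl ℝ E E).mkContinuous 1 fun h => by
    have h1 := (hg h).trans (hp h)
    have h2 := (hg (-h)).trans (hp (-h))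
    rw [hneg1, norm_neg] at h2
    simpa [Real.norm_eq_abs, abs_le] using ⟨by linarith, h1⟩
  have hgΦ : ∀ h, g h = Φ (h, 0) := fun h => rfl
  refine ⟨g, LinearMap.mkContinuous_norm_le _ zero_le_one _, fun h => hg h,
    ContinuousLinearMap.opNorm_le_bound _ hε fun h => ?_⟩
  have h1 := he h
  have h2 := he (-h)
  rw [hneg2, norm_neg] at h2
  have h3 : (f - g) h = Φ (0, h) := by
    rw [_root_.sub_apply, hgΦ, ← hsum h]; ring
  rw [h3, Real.norm_eq_abs, abs_le]
  exact ⟨by linarith, h1⟩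

/-- The directional derivative p of the norm at x is sublinear, and a functional below p norms x
because p(x) ≤ 1 and p(-x) ≤ -1. Uniformity of the limit puts an almost norming f below p + ε‖·‖,
and the sandwich theorem applies. -/
theorem IsSSD.exists_norming_near_of_norm_one (hE : IsSSD E) {x : E} (hx : ‖x‖ = 1)
    {ε : ℝ} (hε : 0 < ε) :
    ∃ δ > 0, ∀ f : StrongDual ℝ E, ‖f‖ ≤ 1 → 1 - δ ≤ f x →
      ∃ g : StrongDual ℝ E, ‖g‖ ≤ 1 ∧ g x = 1 ∧ ‖f - g‖ ≤ ε := by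
  obtain ⟨L, hL⟩ := hE x hx
  -- L is controlled only on the unit sphere, so the derivative is its homogeneous extension.
  let p : E → ℝ := fun h => ‖h‖ * L (‖h‖⁻¹ • h)
  let d : E → ℝ → ℝ := fun h t => (‖x + t • h‖ - ‖x‖) / t
  have hscale : ∀ c : ℝ, 0 < c → Tendsto (fun t : ℝ => c * t) (𝓝[>] 0) (𝓝[>] 0) := by
    intro c hc
    refine tendsto_nhdsWithin_iff.2 ⟨?_, ?_⟩
    · have : Tendsto (fun t : ℝ => c * t) (𝓝 0) (𝓝 (c * 0)) := by
        exact (continuous_const_mul c).tendsto 0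
      rw [mul_zero] at this
      exact this.mono_left nhdsWithin_le_nhds
    · filter_upwards [self_mem_nhdsWithin] with t ht
      exact mul_pos hc ht
  have hlim : ∀ h, Tendsto (d h) (𝓝[>] 0) (𝓝 (p h)) := by
    intro h
    rcases eq_or_ne h 0 with rfl | hh
    · simp [d, p]
    have hn : 0 < ‖h‖ := norm_pos_iff.2 hh
    have h1 := (hL.tendsto_at (show ‖h‖⁻¹ • h ∈ Metric.sphere (0 : E) 1 by
      simp [norm_smul, hn.ne'])).comp (hscale ‖h‖ hn)
    refine (h1.const_mul ‖h‖).congr' ?_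
    filter_upwards [self_mem_nhdsWithin] with t ht
    have ht' : t ≠ 0 := (mem_Ioi.1 ht).ne'
    simp only [Function.comp, d, smul_smul]
    rw [mul_comm ‖h‖ t, mul_inv_cancel_right₀ hn.ne']
    field_simp
  have hd : ∀ h t, 0 < t → d h t ≤ ‖h‖ := by
    intro h t ht
    rw [div_le_iff₀ ht, sub_le_iff_le_add]
    have := norm_add_le x (t • h)
    rw [norm_smul, Real.norm_of_nonneg ht.le] at this
    linarith
  have hp : ∀ h, p h ≤ ‖h‖ := fun h => le_of_tendsto (hlim h) <| by
    filter_upwards [self_mem_nhdsWithin] with t ht using hd h t ht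
  have hhom : ∀ c : ℝ, 0 < c → ∀ h, p (c • h) = c * p h := by
    intro c hc h
    simp only [p]
    rw [norm_smul, Real.norm_of_nonneg hc.le, smul_smul, mul_inv_rev, mul_assoc ‖h‖⁻¹,
      inv_mul_cancel₀ hc.ne', mul_one, mul_assoc]
  have hadd : ∀ h k, p (h + k) ≤ p h + p k := by
    intro h k
    -- The right-hand quotients are taken at 2t, since x + t(h + k) is the midpoint of x + 2th and x
    -- + 2tk.
    refine le_of_tendsto_of_tendsto (hlim (h + k))
      (((hlim h).comp (hscale 2 two_pos)).add ((hlim k).comp (hscale 2 two_pos))) ?_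
    filter_upwards [self_mem_nhdsWithin] with t ht
    have ht' : 0 < t := ht
    simp only [Function.comp, d]
    rw [← add_div, div_le_div_iff₀ ht' (by positivity)]
    have h1 : (2 : ℝ) • (x + t • (h + k)) = (x + (2 * t) • h) + (x + (2 * t) • k) := by
      module
    have h2 := norm_add_le (x + (2 * t) • h) (x + (2 * t) • k)
    rw [← h1, norm_smul, Real.norm_of_nonneg zero_le_two] at h2
    nlinarith
  have hpx : p (-x) ≤ -1 := by
    refine le_of_tendsto (hlim (-x)) ?_
    filter_upwards [Ioo_mem_nhdsGT (zero_lt_one' ℝ)] with t ht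
    have h1 : x + t • -x = (1 - t) • x := by module
    simp only [d]
    rw [h1, norm_smul, hx, Real.norm_of_nonneg (by linarith [ht.2]), div_le_iff₀ ht.1]
    linarith
  obtain ⟨t, hunif, ht⟩ := ((Metric.tendstoUniformlyOn_iff.1 hL (ε / 2) (by positivity)).and
    self_mem_nhdsWithin).exists
  have ht' : 0 < t := ht
  -- After division by t this defect costs ε/2; the other ε/2 is the error of the difference
  -- quotient at t.
  refine ⟨t * (ε / 2), by positivity, fun f hf hfx => ?_⟩
  have hle : ∀ y, f y ≤ ‖y‖ := fun y =>
    (le_abs_self _).trans ((f.le_opNorm y).trans (mul_le_of_le_one_left (norm_nonneg y) hf))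
  have hfp : ∀ h, f h ≤ p h + ε * ‖h‖ := by
    intro h
    rcases eq_or_ne h 0 with rfl | hh
    · simp [p]
    have hn : 0 < ‖h‖ := norm_pos_iff.2 hh
    set e := ‖h‖⁻¹ • h with he
    have h1 := hunif e (by simp [e, norm_smul, hn.ne'])
    rw [dist_comm, Real.dist_eq, abs_lt] at h1
    have h2 : ‖x + t • e‖ - ‖x‖ < (L e + ε / 2) * t := by
      rw [← div_lt_iff₀ ht']; linarith
    have h3 := hle (x + t • e)
    rw [map_add, map_smul, smul_eq_mul] at h3
    have h4 : t * f e ≤ t * (L e + ε) := by linarith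
    have h5 := le_of_mul_le_mul_left h4 ht'
    have h6 : h = ‖h‖ • e := by rw [he, smul_smul, mul_inv_cancel₀ hn.ne', one_smul]
    calc f h = ‖h‖ * f e := by rw [← smul_eq_mul, ← map_smul, ← h6]
      _ ≤ ‖h‖ * (L e + ε) := by gcongr
      _ = p h + ε * ‖h‖ := by simp only [p, ← he]; ring
  obtain ⟨g, hg1, hgp, hfg⟩ := exists_le_sublinear_of_le_add_norm hhom hadd hp hε.le hfp
  refine ⟨g, hg1, le_antisymm ?_ ?_, hfg⟩
  · simpa [hx] using (hgp x).trans (hp x)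
  · have := (hgp (-x)).trans hpx
    rw [map_neg] at this
    linarith

/-- In a space with strongly subdifferentiable norm, functionals in the unit ball that almost
norm `x` are close to functionals that norm `x`. -/
theorem IsSSD.exists_norming_near (hE : IsSSD E) {x : E} (hx : x ≠ 0) {ε : ℝ} (hε : 0 < ε) :
    ∃ δ > 0, ∀ f : StrongDual ℝ E, ‖f‖ ≤ 1 → ‖x‖ - δ ≤ f x →
      ∃ g : StrongDual ℝ E, ‖g‖ ≤ 1 ∧ g x = ‖x‖ ∧ ‖f - g‖ ≤ ε := by
  have hn : 0 < ‖x‖ := norm_pos_iff.2 hx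
  obtain ⟨δ, hδ, h⟩ := hE.exists_norming_near_of_norm_one (x := ‖x‖⁻¹ • x)
    (by simp [norm_smul, hn.ne']) hε
  refine ⟨‖x‖ * δ, by positivity, fun f hf hfx => ?_⟩
  obtain ⟨g, hg1, hgx, hfg⟩ := h f hf (by
    rw [map_smul, smul_eq_mul, ← div_eq_inv_mul, le_div_iff₀ hn]; linarith)
  refine ⟨g, hg1, ?_, hfg⟩
  rwa [map_smul, smul_eq_mul, inv_mul_eq_one₀ hn.ne', eq_comm] at hgx

/-- The dual of a Banach space with strongly subdifferentiable norm has no proper norming closed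
subspace. -/
theorem IsSSD.eq_top_of_isNorming [CompleteSpace E] (hE : IsSSD E)
    {F : Submodule ℝ (StrongDual ℝ E)} (hF : IsClosed (F : Set (StrongDual ℝ E)))
    (hnorm : IsNorming {g : StrongDual ℝ E | g ∈ F ∧ ‖g‖ ≤ 1}) : F = ⊤ := by
  have h := hnorm.dense_span fun x hx u hu hg ε hε => by
    -- g vanishes on a tail of x, so a norming f within ε of g is at most ε there.
    obtain ⟨δ, hδ, hnear⟩ := hE.exists_norming_near hu hε
    obtain ⟨g, hgF, hgu, hgx⟩ := hg δ hδ
    obtain ⟨f, hf1, hfu, hfg⟩ := hnear g hgF.2 hgu.le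
    refine ⟨f, hf1, hfu, ?_⟩
    filter_upwards [hgx] with m hm
    have := (f - g).le_of_opNorm_le (norm_sub_rev g f ▸ hfg) (x m)
    rw [_root_.sub_apply, hm, sub_zero] at this
    exact (le_abs_self _).trans (this.trans (mul_le_of_le_one_right hε.le (hx m)))
  rw [eq_top_iff]
  intro f _
  exact closure_minimal (Submodule.span_le.2 fun g hg => hg.1) hF (h ▸ mem_univ f)

end SSD

/-! ### Duality with operators, and compact operators as a norming subspace -/

section ElementaryTensors

variable {X Y : Type*} [NormedAddCommGroup X] [NormedSpace ℝ X]
    [NormedAddCommGroup Y] [NormedSpace ℝ Y]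

/-- The elementary tensors, as a bilinear map into the algebraic tensor product. -/
noncomputable def algTmul : X →ₗ[ℝ] Y →ₗ[ℝ] AlgTensor X Y := TensorProduct.mk ℝ X Y

theorem norm_algTmul_le (x : X) (y : Y) : ‖algTmul x y‖ ≤ ‖x‖ * ‖y‖ :=
  csInf_le (reprCosts_bddBelow _) ⟨1, fun _ => x, fun _ => y,
    (Fin.sum_univ_one fun _ : Fin 1 => x ⊗ₜ[ℝ] y).symm, by simp⟩

theorem algTensor_induction {p : AlgTensor X Y → Prop} (z : AlgTensor X Y) (zero : p 0)
    (tmul : ∀ x y, p (algTmul x y)) (add : ∀ z w, p z → p w → p (z + w)) : p z :=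
  TensorProduct.induction_on (motive := p) z zero tmul add

variable (X Y) in
/-- The elementary tensors, as a bounded bilinear map into the projective tensor product. -/
noncomputable def tmulL : X →L[ℝ] Y →L[ℝ] ProjTensor X Y :=
  LinearMap.mkContinuous₂
    (algTmul.compr₂ (UniformSpace.Completion.toComplL (𝕜 := ℝ) (E := AlgTensor X Y)).toLinearMap) 1
    fun x y => by simpa using norm_algTmul_le x y

theorem tmulL_apply (x : X) (y : Y) :
    tmulL X Y x y = ((algTmul x y : AlgTensor X Y) : ProjTensor X Y) := rfl

theorem norm_tmulL_le (x : X) (y : Y) : ‖tmulL X Y x y‖ ≤ ‖x‖ * ‖y‖ := by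
  rw [tmulL_apply, UniformSpace.Completion.norm_coe]
  exact norm_algTmul_le x y

variable (X Y) in
/-- The operator `X → Y*` associated with a functional on the projective tensor product. -/
noncomputable def toOperator : StrongDual ℝ (ProjTensor X Y) →L[ℝ] X →L[ℝ] StrongDual ℝ Y :=
  ((ContinuousLinearMap.compL ℝ X (Y →L[ℝ] ProjTensor X Y) (StrongDual ℝ Y)).flip (tmulL X Y)).comp
    (ContinuousLinearMap.compL ℝ Y (ProjTensor X Y) ℝ)

theorem toOperator_apply (φ : StrongDual ℝ (ProjTensor X Y)) (x : X) (y : Y) :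
    toOperator X Y φ x y = φ (tmulL X Y x y) := rfl

theorem norm_toOperator_le (φ : StrongDual ℝ (ProjTensor X Y)) : ‖toOperator X Y φ‖ ≤ ‖φ‖ := by
  refine ContinuousLinearMap.opNorm_le_bound₂ _ (norm_nonneg _) fun x y => ?_
  rw [toOperator_apply, mul_assoc]
  exact (φ.le_opNorm _).trans (mul_le_mul_of_nonneg_left (norm_tmulL_le x y) (norm_nonneg _))

theorem abs_lift_le (T : X →L[ℝ] StrongDual ℝ Y) (L : AlgTensor X Y →ₗ[ℝ] ℝ)
    (hL : ∀ x y, L (algTmul x y) = T x y) (z : AlgTensor X Y) : |L z| ≤ ‖T‖ * ‖z‖ := by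
  refine le_of_forall_pos_le_add fun ε hε => ?_
  have hd : 0 < ε / (‖T‖ + 1) := by positivity
  obtain ⟨r, ⟨n, x, y, hz, hr⟩, hlt⟩ := Real.lt_sInf_add_pos (reprCosts_nonempty z) hd
  have h1 : |L z| ≤ ‖T‖ * r := by
    have hz' : z = ∑ i, algTmul (x i) (y i) := hz
    rw [hz', map_sum, hr, Finset.mul_sum]
    refine (Finset.abs_sum_le_sum_abs _ _).trans (Finset.sum_le_sum fun i _ => ?_)
    rw [hL, ← mul_assoc]
    exact T.le_opNorm₂ _ _
  have h2 : ‖T‖ * r ≤ ‖T‖ * (‖z‖ + ε / (‖T‖ + 1)) :=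
    mul_le_mul_of_nonneg_left hlt.le T.opNorm_nonneg
  have h3 : ‖T‖ * (ε / (‖T‖ + 1)) ≤ ε := by
    rw [← mul_div_assoc, div_le_iff₀ (by positivity)]
    nlinarith [T.opNorm_nonneg]
  linarith [mul_add ‖T‖ ‖z‖ (ε / (‖T‖ + 1))]

theorem norm_le_norm_toOperator (φ : StrongDual ℝ (ProjTensor X Y)) : ‖φ‖ ≤ ‖toOperator X Y φ‖ := by
  refine ContinuousLinearMap.opNorm_le_bound _ (toOperator X Y φ).opNorm_nonneg fun z => ?_
  induction z using UniformSpace.Completion.induction_on with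
  | hp => exact isClosed_le (by fun_prop) (by fun_prop)
  | ih z =>
    rw [UniformSpace.Completion.norm_coe]
    exact abs_lift_le (toOperator X Y φ)
      (φ.comp (UniformSpace.Completion.toComplL (𝕜 := ℝ) (E := AlgTensor X Y))).toLinearMap
      (fun x y => rfl) z

theorem toOperator_surjective (T : X →L[ℝ] StrongDual ℝ Y) : ∃ φ, toOperator X Y φ = T := by
  let L : AlgTensor X Y →ₗ[ℝ] ℝ :=
    TensorProduct.lift ((ContinuousLinearMap.coeLM ℝ).comp T.toLinearMap)
  have hL : ∀ x y, L (algTmul x y) = T x y := fun x y => TensorProduct.lift.tmul x y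
  let e := UniformSpace.Completion.toComplL (𝕜 := ℝ) (E := AlgTensor X Y)
  refine ⟨(L.mkContinuous ‖T‖ (abs_lift_le T L hL)).extend e, ?_⟩
  ext x y
  rw [toOperator_apply, tmulL_apply]
  exact (ContinuousLinearMap.extend_eq _ UniformSpace.Completion.denseRange_coe
    (UniformSpace.Completion.isUniformInducing_coe _) (algTmul x y)).trans (hL x y)

theorem tendsto_apply_coe {ι : Type*} {l : Filter ι} {φ : ι → StrongDual ℝ (ProjTensor X Y)}
    {ψ : StrongDual ℝ (ProjTensor X Y)}
    (h : ∀ x y, Tendsto (fun a => toOperator X Y (φ a) x y) l (𝓝 (toOperator X Y ψ x y)))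
    (z : AlgTensor X Y) :
    Tendsto (fun a => φ a (z : ProjTensor X Y)) l (𝓝 (ψ (z : ProjTensor X Y))) := by
  induction z using algTensor_induction with
  | zero =>
    rw [UniformSpace.Completion.coe_zero]
    simp only [map_zero]
    exact tendsto_const_nhds
  | tmul x y => exact h x y
  | add z w hz hw => simpa [UniformSpace.Completion.coe_add] using hz.add hw

variable (X Y) in
/-- The functionals whose associated operator is compact. -/
noncomputable def compactFunctionals : Submodule ℝ (StrongDual ℝ (ProjTensor X Y)) :=
  (compactOperator (RingHom.id ℝ) X (StrongDual ℝ Y)).comap (toOperator X Y).toLinearMap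

theorem mem_compactFunctionals {φ : StrongDual ℝ (ProjTensor X Y)} :
    φ ∈ compactFunctionals X Y ↔ IsCompactOperator (toOperator X Y φ) := Iff.rfl

theorem isClosed_compactFunctionals :
    IsClosed (compactFunctionals X Y : Set (StrongDual ℝ (ProjTensor X Y))) :=
  isClosed_setOfPred_isCompactOperator.preimage (toOperator X Y).continuous

/-- If every operator in the unit ball is approximable in the weak operator topology by compact
operators in the unit ball, then the compact operators are norming. -/
theorem isNorming_compactFunctionals
    (h : ∀ T : X →L[ℝ] StrongDual ℝ Y, ‖T‖ ≤ 1 → ∃ (ι : Type _) (l : Filter ι) (_ : l.NeBot)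
      (S : ι → X →L[ℝ] StrongDual ℝ Y), (∀ a, IsCompactOperator (S a)) ∧ (∀ a, ‖S a‖ ≤ 1) ∧
      ∀ x y, Tendsto (fun a => S a x y) l (𝓝 (T x y))) :
    IsNorming {φ | φ ∈ compactFunctionals X Y ∧ ‖φ‖ ≤ 1} := by
  refine ⟨fun φ hφ => hφ.2, fun z r hr => ?_⟩
  set η := (‖z‖ - r) / 2 with hη
  have hη0 : 0 < η := by linarith
  obtain ⟨w, hw⟩ := UniformSpace.Completion.denseRange_coe.exists_dist_lt z hη0
  rw [dist_eq_norm] at hw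
  -- Convergence is known only on algebraic tensors, so half of the gap ‖z‖ - r pays for replacing z
  -- by w in the norm and half for returning from w to z.
  obtain ⟨ψ, hψ, hψw⟩ := exists_dual_vector'' ℝ (w : ProjTensor X Y)
  obtain ⟨ι, l, hl, S, hSc, hS1, hS⟩ := h _ ((norm_toOperator_le ψ).trans hψ)
  choose φ hφ using fun a => toOperator_surjective (S a)
  have hwr : r + η < ψ w := by
    rw [hψw]
    have := norm_sub_norm_le z (w : ProjTensor X Y)
    simp only [RCLike.ofReal_real_eq_id, id]
    linarith
  have hlim := tendsto_apply_coe (φ := φ) (ψ := ψ) (l := l)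
    (fun x y => by simpa only [hφ] using hS x y) w
  obtain ⟨a, ha⟩ := (hlim.eventually (lt_mem_nhds hwr)).exists
  have hφ1 : ‖φ a‖ ≤ 1 := by
    have := norm_le_norm_toOperator (φ a)
    rw [hφ] at this
    exact this.trans (hS1 a)
  refine ⟨φ a, ⟨by rw [mem_compactFunctionals, hφ]; exact hSc a, hφ1⟩, ?_⟩
  have h1 := (φ a).le_of_opNorm_le hφ1 (z - w)
  rw [map_sub, Real.norm_eq_abs, one_mul] at h1
  have := neg_abs_le (φ a z - φ a w)
  linarith

theorem isCompactOperator_of_finiteDimensional_range {V W : Type*} [NormedAddCommGroup V]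
    [NormedSpace ℝ V] [NormedAddCommGroup W] [NormedSpace ℝ W] (S : V →L[ℝ] W)
    [FiniteDimensional ℝ (LinearMap.range S.toLinearMap)] : IsCompactOperator S := by
  have : ProperSpace (LinearMap.range S.toLinearMap) := FiniteDimensional.proper ℝ _
  exact (isCompactOperator_of_locallyCompactSpace_dom
    (S.codRestrict (LinearMap.range S.toLinearMap) fun x => ⟨x, rfl⟩)).clm_comp
    (LinearMap.range S.toLinearMap).subtypeL

/-- The adjoint of S factors through the dual of the range of S, which is finite-dimensional. -/
theorem isCompactOperator_precomp_of_finiteDimensional_range {V : Type*} [NormedAddCommGroup V]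
    [NormedSpace ℝ V] (S : V →L[ℝ] V) [FiniteDimensional ℝ (LinearMap.range S.toLinearMap)] :
    IsCompactOperator fun f : StrongDual ℝ V => f.comp S := by
  have : LocallyCompactSpace (StrongDual ℝ (LinearMap.range S.toLinearMap)) :=
    LocallyCompactSpace.of_finiteDimensional_of_complete ℝ _
  exact (isCompactOperator_of_locallyCompactSpace_dom
    ((LinearMap.range S.toLinearMap).subtypeL.precomp ℝ)).clm_comp
    ((S.codRestrict (LinearMap.range S.toLinearMap) fun x => ⟨x, rfl⟩).precomp ℝ)

theorem HasMAP.isNorming_left (hX : HasMAP X) :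
    IsNorming {φ | φ ∈ compactFunctionals X Y ∧ ‖φ‖ ≤ 1} := by
  obtain ⟨ι, _, _, _, S, hfin, hS1, hS⟩ := hX
  refine isNorming_compactFunctionals fun T hT => ⟨ι, atTop, inferInstance, fun a => T.comp (S a),
    fun a => ?_, fun a => ?_, fun x y => ?_⟩
  · have := hfin a
    exact (isCompactOperator_of_finiteDimensional_range (S a)).clm_comp T
  · exact (T.opNorm_comp_le _).trans (mul_le_one₀ hT (norm_nonneg _) (hS1 a))
  · exact ((T.flip y).continuous.tendsto x).comp (hS x)

theorem HasMAP.isNorming_right (hY : HasMAP Y) :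
    IsNorming {φ | φ ∈ compactFunctionals X Y ∧ ‖φ‖ ≤ 1} := by
  obtain ⟨ι, _, _, _, S, hfin, hS1, hS⟩ := hY
  refine isNorming_compactFunctionals fun T hT => ⟨ι, atTop, inferInstance,
    fun a => ((ContinuousLinearMap.compL ℝ Y Y ℝ).flip (S a)).comp T,
    fun a => ?_, fun a => ?_, fun x y => ?_⟩
  · have := hfin a
    exact (isCompactOperator_precomp_of_finiteDimensional_range (S a)).comp_clm T
  · refine ContinuousLinearMap.opNorm_le_bound _ zero_le_one fun x => ?_
    refine ((T x).opNorm_comp_le (S a)).trans ?_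
    rw [one_mul]
    exact (mul_le_of_le_one_right (norm_nonneg _) (hS1 a)).trans
      ((T.le_opNorm x).trans (mul_le_of_le_one_left (norm_nonneg _) hT))
  · exact ((T x).continuous.tendsto y).comp (hS y)

end ElementaryTensors

/-! ### Weak limits along ultrafilters -/

section WeakLimits

/-- Banach–Alaoglu; an ultrafilter gives convergence without passing to subnets. -/
theorem exists_weakStar_limit {E ι : Type*} [NormedAddCommGroup E] [NormedSpace ℝ E]
    (U : Ultrafilter ι) {φ : ι → StrongDual ℝ E} (hφ : ∀ i, ‖φ i‖ ≤ 1) :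
    ∃ ψ : StrongDual ℝ E, ‖ψ‖ ≤ 1 ∧ ∀ x, Tendsto (fun i => φ i x) U (𝓝 (ψ x)) := by
  obtain ⟨ψ, hψ, hlim⟩ := (WeakDual.isCompact_closedBall (0 : StrongDual ℝ E) 1).ultrafilter_le_nhds
    (U.map fun i => StrongDual.toWeakDual (φ i)) (le_principal_iff.2 <|
      Filter.mem_map.2 <| univ_mem' fun i => by simpa using hφ i)
  refine ⟨WeakDual.toStrongDual ψ, by simpa using hψ, fun x => ?_⟩
  exact ((WeakDual.eval_continuous x).tendsto ψ).comp (show Tendsto _ _ _ from hlim)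

theorem IsReflexiveSpace.exists_weak_limit {E ι : Type*} [NormedAddCommGroup E] [NormedSpace ℝ E]
    (hE : IsReflexiveSpace E) (U : Ultrafilter ι) {x : ι → E} (hx : ∀ i, ‖x i‖ ≤ 1) :
    ∃ a : E, ‖a‖ ≤ 1 ∧ ∀ f : StrongDual ℝ E, Tendsto (fun i => f (x i)) U (𝓝 (f a)) := by
  obtain ⟨ψ, hψ, hlim⟩ := exists_weakStar_limit U
    (φ := fun i => NormedSpace.inclusionInDoubleDual ℝ E (x i))
    fun i => (NormedSpace.double_dual_bound ℝ E (x i)).trans (hx i)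
  obtain ⟨a, rfl⟩ := hE ψ
  refine ⟨a, ?_, hlim⟩
  rw [← (NormedSpace.inclusionInDoubleDualLi (E := E) ℝ).norm_map a]
  exact hψ

theorem isClosed_range_inclusionInDoubleDual {E : Type*} [NormedAddCommGroup E] [NormedSpace ℝ E]
    [CompleteSpace E] : IsClosed (range (NormedSpace.inclusionInDoubleDual ℝ E)) :=
  (NormedSpace.inclusionInDoubleDualLi
    (E := E) ℝ).isometry.isUniformInducing.isComplete_range.isClosed

variable {X Y : Type*} [NormedAddCommGroup X] [NormedSpace ℝ X]
    [NormedAddCommGroup Y] [NormedSpace ℝ Y]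

/-- The bilinear form of a compact operator is jointly weakly continuous on bounded sets. -/
theorem tendsto_apply_apply_of_isCompactOperator {ι : Type*} {U : Ultrafilter ι}
    {T : X →L[ℝ] StrongDual ℝ Y} (hT : IsCompactOperator T) {x : ι → X} {y : ι → Y} {a : X} {b : Y}
    (hx1 : ∀ i, ‖x i‖ ≤ 1) (hy1 : ∀ i, ‖y i‖ ≤ 1)
    (hx : ∀ f : StrongDual ℝ X, Tendsto (fun i => f (x i)) U (𝓝 (f a)))
    (hy : ∀ f : StrongDual ℝ Y, Tendsto (fun i => f (y i)) U (𝓝 (f b))) :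
    Tendsto (fun i => T (x i) (y i)) U (𝓝 (T a b)) := by
  have hK : IsCompact (closure (T '' Metric.closedBall 0 1)) :=
    IsCompactOperator.isCompact_closure_image_closedBall (f := T.toLinearMap) hT 1
  obtain ⟨v, -, hv⟩ := hK.ultrafilter_le_nhds (U.map fun i => T (x i)) (le_principal_iff.2 <|
    Filter.mem_map.2 <| univ_mem' fun i =>
      subset_closure (mem_image_of_mem T (by simpa using hx1 i)))
  replace hv : Tendsto (fun i => T (x i)) U (𝓝 v) := hv
  -- Compactness gives a norm limit of T (x i); testing against each z in Y identifies it with the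
  -- weak limit T a.
  have hva : v = T a := by
    ext z
    exact tendsto_nhds_unique
      (((ContinuousLinearMap.apply ℝ ℝ z).continuous.tendsto v).comp hv) (hx (T.flip z))
  subst hva
  have h1 : Tendsto (fun i => (T (x i) - T a) (y i)) U (𝓝 0) := by
    refine squeeze_zero_norm (fun i => ?_) (tendsto_iff_norm_sub_tendsto_zero.1 hv)
    exact ((T (x i) - T a).le_opNorm _).trans (mul_le_of_le_one_right (norm_nonneg _) (hy1 i))
  simpa using h1.add (hy (T a))

end WeakLimits

/-! ### Reflexivity of the projective tensor product -/

section Reflexivity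

variable {X Y : Type*} [NormedAddCommGroup X] [NormedSpace ℝ X]
    [NormedAddCommGroup Y] [NormedSpace ℝ Y]

variable (X Y) in
/-- The elementary tensors of unit vectors, as functionals on the dual of the projective tensor
product. -/
def tmulFunctionals : Set (StrongDual ℝ (StrongDual ℝ (ProjTensor X Y))) :=
  {g | ∃ x y, ‖x‖ ≤ 1 ∧ ‖y‖ ≤ 1 ∧ g = NormedSpace.inclusionInDoubleDual ℝ _ (tmulL X Y x y)}

theorem norm_inclusion_tmulL_le {x : X} {y : Y} (hx : ‖x‖ ≤ 1) (hy : ‖y‖ ≤ 1) :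
    ‖NormedSpace.inclusionInDoubleDual ℝ _ (tmulL X Y x y)‖ ≤ 1 :=
  (NormedSpace.double_dual_bound ℝ _ _).trans
    ((norm_tmulL_le x y).trans (mul_le_one₀ hx (norm_nonneg _) hy))

theorem isNorming_tmulFunctionals : IsNorming (tmulFunctionals X Y) := by
  refine ⟨?_, fun φ r hr => ?_⟩
  · rintro _ ⟨x, y, hx, hy, rfl⟩
    exact norm_inclusion_tmulL_le hx hy
  · by_contra! hcon
    have hle : ∀ x y, ‖x‖ ≤ 1 → ‖y‖ ≤ 1 → toOperator X Y φ x y ≤ r := fun x y hx hy =>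
      hcon _ ⟨x, y, hx, hy, rfl⟩
    have hr0 : 0 ≤ r := by simpa using hle 0 0 (by simp) (by simp)
    refine hr.not_ge ((norm_le_norm_toOperator φ).trans ?_)
    refine ContinuousLinearMap.opNorm_le_of_unit_norm hr0 fun x hx => ?_
    refine ContinuousLinearMap.opNorm_le_of_unit_norm hr0 fun y hy => ?_
    have h1 := hle x y hx.le hy.le
    have h2 := hle x (-y) hx.le (by simpa using hy.le)
    rw [map_neg] at h2
    rw [Real.norm_eq_abs, abs_le]
    constructor <;> linarith

/-- If all operators from `X` to the dual of `Y` are compact and both spaces are reflexive, then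
their projective tensor product is reflexive. -/
theorem isReflexiveSpace_projTensor (hT : ∀ T : X →L[ℝ] StrongDual ℝ Y, IsCompactOperator T)
    (hX : IsReflexiveSpace X) (hY : IsReflexiveSpace Y) : IsReflexiveSpace (ProjTensor X Y) := by
  have hdense := (isNorming_tmulFunctionals (X := X) (Y := Y)).dense_span
    fun φ hφ ψ hψ hg ε hε => by
    have hk : ∀ k : ℕ, ∃ x y, ‖x‖ ≤ 1 ∧ ‖y‖ ≤ 1 ∧ ‖ψ‖ - 1 / ((k : ℝ) + 1) < ψ (tmulL X Y x y) ∧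
        ∀ᶠ m in atTop, φ m (tmulL X Y x y) = 0 := by
      intro k
      obtain ⟨_, ⟨x, y, hx, hy, rfl⟩, h1, h2⟩ := hg (1 / ((k : ℝ) + 1)) (by positivity)
      exact ⟨x, y, hx, hy, h1, h2⟩
    choose x y hx hy hψk hφk using hk
    obtain ⟨a, ha, hxa⟩ := hX.exists_weak_limit (hyperfilter ℕ) hx
    obtain ⟨b, hb, hyb⟩ := hY.exists_weak_limit (hyperfilter ℕ) hy
    -- The tensors of x k and y k converge weakly to that of a and b, because every θ is a compact
    -- operator; hence the limit tensor norms ψ.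
    have hlim : ∀ θ : StrongDual ℝ (ProjTensor X Y), Tendsto (fun k => θ (tmulL X Y (x k) (y k)))
        (hyperfilter ℕ) (𝓝 (θ (tmulL X Y a b))) := fun θ =>
      tendsto_apply_apply_of_isCompactOperator (hT (toOperator X Y θ)) hx hy hxa hyb
    have hf1 := norm_inclusion_tmulL_le ha hb
    refine ⟨NormedSpace.inclusionInDoubleDual ℝ _ (tmulL X Y a b), hf1, le_antisymm ?_ ?_, ?_⟩
    · exact (le_abs_self _).trans ((ContinuousLinearMap.le_opNorm _ ψ).trans
        (mul_le_of_le_one_left (norm_nonneg _) hf1))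
    · have h1 : Tendsto (fun k : ℕ => ‖ψ‖ - 1 / ((k : ℝ) + 1)) (hyperfilter ℕ) (𝓝 ‖ψ‖) := by
        have := tendsto_one_div_add_atTop_nhds_zero_nat.const_sub ‖ψ‖
        rw [sub_zero] at this
        exact this.mono_left Nat.hyperfilter_le_atTop
      exact le_of_tendsto_of_tendsto' h1 (hlim ψ) fun k => (hψk k).le
    · by_contra hcon
      have hfreq : ∃ᶠ m in atTop, ε < φ m (tmulL X Y a b) := by
        simpa [Filter.Frequently] using hcon
      have hne : (atTop ⊓ 𝓟 {m | ε < φ m (tmulL X Y a b)}).NeBot := frequently_mem_iff_neBot.1 hfreq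
      let V : Ultrafilter ℕ := Ultrafilter.of (atTop ⊓ 𝓟 {m | ε < φ m (tmulL X Y a b)})
      have hV := Ultrafilter.of_le (atTop ⊓ 𝓟 {m | ε < φ m (tmulL X Y a b)})
      -- This exchanges the limits in m and k: a weak* limit θ of the offending φ m kills every
      -- tensor of x k and y k, hence also their weak limit, where it should be at least ε.
      obtain ⟨θ, -, hθ⟩ := exists_weakStar_limit V hφ
      have hθk : ∀ k, θ (tmulL X Y (x k) (y k)) = 0 := fun k =>
        tendsto_nhds_unique (hθ _) (tendsto_const_nhds.congr' <|
          ((hφk k).filter_mono (hV.trans inf_le_left)).mono fun m hm => hm.symm)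
      have h0 : θ (tmulL X Y a b) = 0 :=
        tendsto_nhds_unique (hlim θ) (by simp [hθk])
      have hε' : ε ≤ θ (tmulL X Y a b) := ge_of_tendsto (hθ _) <| by
        filter_upwards [(hV.trans inf_le_right) (mem_principal_self _)] with m hm using hm.le
      linarith
  have hspan : Submodule.span ℝ (tmulFunctionals X Y) ≤
      LinearMap.range (NormedSpace.inclusionInDoubleDual ℝ (ProjTensor X Y)).toLinearMap :=
    Submodule.span_le.2 (by rintro _ ⟨x, y, -, -, rfl⟩; exact ⟨_, rfl⟩)
  exact fun Θ => closure_minimal (t := range (NormedSpace.inclusionInDoubleDual ℝ (ProjTensor X Y)))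
    (fun g hg => hspan hg) isClosed_range_inclusionInDoubleDual (hdense ▸ mem_univ Θ)

end Reflexivity

end BanachTensor

theorem theorem2p1 {X Y : Type*}
    [NormedAddCommGroup X] [NormedSpace ℝ X] [CompleteSpace X]
    [NormedAddCommGroup Y] [NormedSpace ℝ Y] [CompleteSpace Y]
    (hMAP : BanachTensor.HasMAP X ∨ BanachTensor.HasMAP Y)
    (hSSD : BanachTensor.IsSSD (BanachTensor.ProjTensor X Y)) :
    (∀ T : X →L[ℝ] StrongDual ℝ Y, IsCompactOperator T) ∧
    (BanachTensor.IsReflexiveSpace X → BanachTensor.IsReflexiveSpace Y →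
      BanachTensor.IsReflexiveSpace (BanachTensor.ProjTensor X Y)) := by
  have hcompact : ∀ T : X →L[ℝ] StrongDual ℝ Y, IsCompactOperator T := by
    intro T
    have htop := hSSD.eq_top_of_isNorming BanachTensor.isClosed_compactFunctionals
      (hMAP.elim (fun h => h.isNorming_left) fun h => h.isNorming_right)
    obtain ⟨φ, rfl⟩ := BanachTensor.toOperator_surjective T
    exact BanachTensor.mem_compactFunctionals.1 (htop ▸ Submodule.mem_top)
  exact ⟨hcompact, BanachTensor.isReflexiveSpace_projTensor hcompact⟩
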